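/- Let $K$ be a field and let $A$ be a connected finite-dimensional $K$-algebra (not a product of two nonzero algebras) that is a Nakayama algebra, i.e. every indecomposable projective left or right $A$-module is uniserial. Assume that $A$ is not selfinjective, and let $n$ be the number of isomorphism classes of simple $A$-modules. All modules are finitely generated modules on a fixed side. For a module $M$ with minimal injective coresolution $0\to M\to I_0\to I_1\to\cdots$, the dominant dimension $\operatorname{domdim}(M)$ is $0$ if $I_0$ is not projective, and $\sup\{m\ge 0 : I_0,\dots,I_m \text{ are projective}\}+1$ otherwise. Let $\operatorname{domdim}(A)$ be the dominant dimension of the regular module. Let the defect $\operatorname{Def}(A)$ be the number of isomorphism classes of indecomposable injective non-projective $A$-modules. Let the super dominant dimension $\operatorname{sdomdim}(A)$ be the sum of $\operatorname{domdim}(P)$ over the isomorphism classes of indecomposable projective non-injective $A$-modules $P$. Then: 1. $\operatorname{sdomdim}(A)\le 2n-2$. 2. $\operatorname{domdim}(A)$ and $\operatorname{Def}(A)$ are finite, $\operatorname{Def}(A)\ge 1$, and $\operatorname{domdim}(A)\le \dfrac{2n-2}{\operatorname{Def}(A)}$. 3. If $\operatorname{domdim}(A)\ge n$, then $\operatorname{Def}(A)=1$.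 -/

import Mathlib

universe u v

/-! Modules are left modules.  Over a ring `R : Type u` all modules live in `Type u`. -/

/-- A module is uniserial if its submodules are totally ordered by inclusion. -/
def IsUniserial (R : Type u) [Ring R] (M : Type u) [AddCommGroup M] [Module R M] : Prop :=
  ∀ N N' : Submodule R M, N ≤ N' ∨ N' ≤ N

/-- A module is indecomposable if it is nonzero and not a direct sum of two nonzero submodules. -/
def IsIndecomposable (R : Type u) [Ring R] (M : Type u) [AddCommGroup M] [Module R M] : Prop :=
  Nontrivial M ∧ ∀ N N' : Submodule R M, IsCompl N N' → N = ⊥ ∨ N' = ⊥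

/-- A submodule is essential if it meets every nonzero submodule nontrivially. -/
def IsEssentialSubmodule {R : Type u} [Ring R] {M : Type u} [AddCommGroup M] [Module R M]
    (N : Submodule R M) : Prop :=
  ∀ L : Submodule R M, N ⊓ L = ⊥ → L = ⊥

/-- Every finitely generated indecomposable projective left module is uniserial. -/
def IsLeftSerial (R : Type u) [Ring R] : Prop :=
  ∀ (P : Type u) [AddCommGroup P] [Module R P],
    Module.Finite R P → Module.Projective R P → IsIndecomposable R P → IsUniserial R P

/-- Every indecomposable left or right projective module is uniserial
(right `R`-modules are left modules over the opposite ring). -/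
def IsNakayama (R : Type u) [Ring R] : Prop :=
  IsLeftSerial R ∧ IsLeftSerial Rᵐᵒᵖ

/-- The ring is nonzero and is not a product of two nonzero rings. -/
def IsConnectedRing (R : Type u) [Ring R] : Prop :=
  Nontrivial R ∧ ∀ e : R, IsIdempotentElem e → (∀ r : R, e * r = r * e) → e = 0 ∨ e = 1

/-- A ring is (left) selfinjective if the regular left module is injective. -/
def IsSelfinjective (R : Type u) [Ring R] : Prop :=
  Module.Injective R R

/-- A minimal injective coresolution `0 → M → I 0 → I 1 → ⋯`: an exact sequence with injective
terms in which each `I i` is an injective hull of the image of the map that enters it. -/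
structure MinimalInjectiveCoresolution (R : Type u) [Ring R]
    (M : Type u) [AddCommGroup M] [Module R M] where
  /-- the terms -/
  I : ℕ → ModuleCat.{u} R
  /-- the coaugmentation -/
  ε : M →ₗ[R] I 0
  /-- the differentials -/
  d : ∀ i, I i →ₗ[R] I (i + 1)
  injective : ∀ i, Module.Injective R (I i)
  ε_injective : Function.Injective ε
  exact_zero : Function.Exact ε (d 0)
  exact_succ : ∀ i, Function.Exact (d i) (d (i + 1))
  essential_zero : IsEssentialSubmodule (LinearMap.range ε)
  essential_succ : ∀ i, IsEssentialSubmodule (LinearMap.range (d i))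

namespace MinimalInjectiveCoresolution

/-- The number of leading projective terms: the supremum of all `k` such that
`I 0, …, I (k - 1)` are projective. -/
noncomputable def projLength {R : Type u} [Ring R] {M : Type u} [AddCommGroup M] [Module R M]
    (C : MinimalInjectiveCoresolution R M) : ℕ∞ :=
  ⨆ (k : ℕ) (_ : ∀ i < k, Module.Projective R (C.I i)), (k : ℕ∞)

/-- Transport along an isomorphism. -/
def ofEquiv {R : Type u} [Ring R] {M N : Type u} [AddCommGroup M] [Module R M]
    [AddCommGroup N] [Module R N] (C : MinimalInjectiveCoresolution R M) (e : N ≃ₗ[R] M) :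
    MinimalInjectiveCoresolution R N where
  I := C.I
  ε := C.ε ∘ₗ e.toLinearMap
  d := C.d
  injective := C.injective
  ε_injective := C.ε_injective.comp e.injective
  exact_zero := by
    intro y
    rw [C.exact_zero y]
    constructor
    · rintro ⟨x, rfl⟩
      exact ⟨e.symm x, by simp⟩
    · rintro ⟨x, rfl⟩
      exact ⟨e x, rfl⟩
  exact_succ := C.exact_succ
  essential_zero := by
    rw [LinearEquiv.range_comp]
    exact C.essential_zero
  essential_succ := C.essential_succ

end MinimalInjectiveCoresolution

/-- The dominant dimension of a module.  Minimal injective coresolutions are unique up to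
isomorphism, so the supremum is the common value of `projLength`: it is `0` if `I 0` is not
projective and `sup {m | I 0, …, I m are projective} + 1` otherwise. -/
noncomputable def domDim (R : Type u) [Ring R] (M : Type u) [AddCommGroup M] [Module R M] : ℕ∞ :=
  ⨆ C : MinimalInjectiveCoresolution R M, C.projLength

theorem domDim_le_of_equiv {R : Type u} [Ring R] {M N : Type u} [AddCommGroup M] [Module R M]
    [AddCommGroup N] [Module R N] (e : N ≃ₗ[R] M) : domDim R M ≤ domDim R N :=
  iSup_le fun C => le_iSup (fun C' : MinimalInjectiveCoresolution R N => C'.projLength)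
    (C.ofEquiv e)

theorem domDim_congr {R : Type u} [Ring R] {M N : Type u} [AddCommGroup M] [Module R M]
    [AddCommGroup N] [Module R N] (e : M ≃ₗ[R] N) : domDim R M = domDim R N :=
  le_antisymm (domDim_le_of_equiv e.symm) (domDim_le_of_equiv e)

/-- Isomorphism of modules, on the modules with property `p`. -/
def isoSetoid (R : Type u) [Ring R] (p : ModuleCat.{u} R → Prop) :
    Setoid {M : ModuleCat.{u} R // p M} where
  r M N := Nonempty (M.1 ≃ₗ[R] N.1)
  iseqv :=
    ⟨fun M => ⟨LinearEquiv.refl R M.1⟩, fun ⟨e⟩ => ⟨e.symm⟩, fun ⟨e⟩ ⟨f⟩ => ⟨e.trans f⟩⟩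

/-- The isomorphism classes of modules with property `p`. -/
def IsoClasses (R : Type u) [Ring R] (p : ModuleCat.{u} R → Prop) : Type (u + 1) :=
  Quotient (isoSetoid R p)

/-- The dominant dimension of an isomorphism class. -/
noncomputable def IsoClasses.domDim {R : Type u} [Ring R] {p : ModuleCat.{u} R → Prop}
    (c : IsoClasses R p) : ℕ∞ :=
  Quotient.lift (s := isoSetoid R p) (fun M => _root_.domDim R M.1)
    (fun _ _ ⟨e⟩ => domDim_congr e) c

/-- The number of isomorphism classes of simple modules. -/
noncomputable def numSimples (R : Type u) [Ring R] : ℕ∞ :=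
  ENat.card (IsoClasses R fun M => IsSimpleModule R M)

/-- Finitely generated indecomposable injective non-projective modules. -/
def IsIndecInjNonProj (R : Type u) [Ring R] (M : ModuleCat.{u} R) : Prop :=
  Module.Finite R M ∧ IsIndecomposable R M ∧ Module.Injective R M ∧ ¬ Module.Projective R M

/-- Finitely generated indecomposable projective non-injective modules. -/
def IsIndecProjNonInj (R : Type u) [Ring R] (M : ModuleCat.{u} R) : Prop :=
  Module.Finite R M ∧ IsIndecomposable R M ∧ Module.Projective R M ∧ ¬ Module.Injective R M

/-- The defect: the number of isomorphism classes of indecomposable injective non-projective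
modules. -/
noncomputable def defect (R : Type u) [Ring R] : ℕ∞ :=
  ENat.card (IsoClasses R (IsIndecInjNonProj R))

/-- The super dominant dimension: the sum (the supremum of the finite partial sums) of the dominant
dimensions of the indecomposable projective non-injective modules, one from each isomorphism
class. -/
noncomputable def superDomDim (R : Type u) [Ring R] : ℕ∞ :=
  ⨆ s : Finset (IsoClasses R (IsIndecProjNonInj R)), ∑ c ∈ s, c.domDim

/-! ### Factorisations, retracts and uniserial modules -/

section Maps

variable {R : Type u} [Ring R] {M N P Q : Type u} [AddCommGroup M] [Module R M]
  [AddCommGroup N] [Module R N] [AddCommGroup P] [Module R P] [AddCommGroup Q] [Module R Q]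

/-! Let `P` be indecomposable projective non-injective, with a projective injective coresolution of
length `d`. A uniserial module embeds in a single summand of any projective injective module
containing it, so the terms `I 0, …, I (d - 1)` can be chosen indecomposable, hence uniserial. The
cosyzygies `M 0 = P, M 1, …, M d` are then nonzero with projective covers `P, I 0, …, I (d - 1)`.

The key point is that the cover of `M (k + 2)` determines that of `M k`, even between different `P`
(`IsCosyzygy.nonempty_equiv_of_add_two`): two candidates for `M (k + 1)` are nested in the uniserial
module `I (k + 1)`, and the inclusion lifts to a surjection between their syzygies. Descending in
steps of two, a coincidence between a cover in an even position and one at least as late reaches a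
starting module. That module is not injective, whereas all later covers are, so the two positions
and the two starting modules agree (`IsCosyzygy.eq_of_even`).

Hence the covers in even positions, for all `P` together, are distinct among at most `n`
indecomposable projectives, and `∑ (⌊d / 2⌋ + 1) ≤ n`. For `r` modules this gives `∑ d ≤ 2n - r`,
enough when `r ≥ 2`; a single module needs one extra cover when `d` is odd (`half_succ_le`).

Each such `P` inherits coresolutions from the regular module, and counting socles and tops shows
that there are at least as many such `P` as the defect. This bounds the product of dominant
dimension and defect. The defect is nonzero, since otherwise all finitely generated injectives would
be projective and coresolutions of every length would exist. -/

theorem LinearMap.exists_factor_of_surjective (g : M →ₗ[R] N) (hg : Function.Surjective g)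
    (h : M →ₗ[R] P) (hk : ∀ x, g x = 0 → h x = 0) : ∃ k : N →ₗ[R] P, ∀ x, k (g x) = h x := by
  refine ⟨(LinearMap.ker g).liftQ h (fun x hx => hk x hx) ∘ₗ
    (g.quotKerEquivOfSurjective hg).symm.toLinearMap, fun x => ?_⟩
  have : (g.quotKerEquivOfSurjective hg).symm (g x) = (LinearMap.ker g).mkQ x := by
    rw [LinearEquiv.symm_apply_eq]; rfl
  rw [LinearMap.comp_apply, LinearEquiv.coe_coe, this]
  rfl

theorem LinearMap.exists_factor_of_injective (f : N →ₗ[R] P) (hf : Function.Injective f)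
    (h : M →ₗ[R] P) (hr : LinearMap.range h ≤ LinearMap.range f) :
    ∃ k : M →ₗ[R] N, ∀ x, f (k x) = h x := by
  refine ⟨(LinearEquiv.ofInjective f hf).symm.toLinearMap ∘ₗ
    h.codRestrict (LinearMap.range f) (fun x => hr ⟨x, rfl⟩), fun x => ?_⟩
  have := (LinearEquiv.ofInjective f hf).apply_symm_apply
    (h.codRestrict (LinearMap.range f) (fun x => hr ⟨x, rfl⟩) x)
  exact congrArg Subtype.val this

theorem Module.Injective.of_retract (hM : Module.Injective R M) (i : N →ₗ[R] M) (p : M →ₗ[R] N)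
    (h : ∀ x, p (i x) = x) : Module.Injective R N where
  out X Y _ _ _ _ f hf g := by
    obtain ⟨k, hk⟩ := hM.out f hf (i ∘ₗ g)
    exact ⟨p ∘ₗ k, fun x => by simp [hk, h]⟩

theorem Module.Projective.of_retract (hM : Module.Projective R M) (i : N →ₗ[R] M)
    (p : M →ₗ[R] N) (h : ∀ x, p (i x) = x) : Module.Projective R N :=
  Module.Projective.of_split i p (LinearMap.ext h)

theorem Module.Injective.prod (hM : Module.Injective R M) (hN : Module.Injective R N) :
    Module.Injective R (M × N) where
  out X Y _ _ _ _ f hf g := by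
    obtain ⟨k, hk⟩ := hM.out f hf (LinearMap.fst R M N ∘ₗ g)
    obtain ⟨l, hl⟩ := hN.out f hf (LinearMap.snd R M N ∘ₗ g)
    exact ⟨k.prod l, fun x => by ext <;> simp [hk, hl]⟩

/-- A monomorphism from an injective module splits. -/
theorem Module.Injective.exists_retraction (hM : Module.Injective R M) (f : M →ₗ[R] N)
    (hf : Function.Injective f) : ∃ p : N →ₗ[R] M, ∀ x, p (f x) = x :=
  hM.out f hf LinearMap.id

/-- An epimorphism onto a projective module splits. -/
theorem Module.Projective.exists_section (hN : Module.Projective R N) (g : M →ₗ[R] N)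
    (hg : Function.Surjective g) : ∃ s : N →ₗ[R] M, ∀ x, g (s x) = x := by
  obtain ⟨s, hs⟩ := Module.projective_lifting_property g LinearMap.id hg
  exact ⟨s, fun x => LinearMap.congr_fun hs x⟩

theorem isCompl_range_ker_of_retraction (i : N →ₗ[R] M) (p : M →ₗ[R] N) (h : ∀ x, p (i x) = x) :
    IsCompl (LinearMap.range i) (LinearMap.ker p) := by
  constructor
  · rw [disjoint_iff, eq_bot_iff]
    rintro _ ⟨⟨x, rfl⟩, hx⟩
    have : p (i x) = 0 := hx
    rw [h] at this
    simp [this]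
  · rw [codisjoint_iff, eq_top_iff]
    intro x _
    have : x = i (p x) + (x - i (p x)) := by abel
    rw [this]
    exact Submodule.add_mem_sup ⟨_, rfl⟩ (by simp [h])

/-- A nonzero retract of an indecomposable module is the whole module. -/
theorem IsIndecomposable.bijective_of_retract (hM : IsIndecomposable R M) [Nontrivial N]
    (i : N →ₗ[R] M) (p : M →ₗ[R] N) (h : ∀ x, p (i x) = x) : Function.Bijective p := by
  refine ⟨?_, fun x => ⟨i x, h x⟩⟩
  rcases hM.2 _ _ (isCompl_range_ker_of_retraction i p h) with h0 | h0
  · obtain ⟨x, hx⟩ := exists_ne (0 : N)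
    have : i x = 0 := by
      rw [← Submodule.mem_bot R, ← h0]; exact ⟨x, rfl⟩
    exact absurd (by rw [← h x, this, map_zero]) hx
  · exact LinearMap.ker_eq_bot.1 h0

theorem IsIndecomposable.of_equiv (hM : IsIndecomposable R M) (e : M ≃ₗ[R] N) :
    IsIndecomposable R N := by
  obtain ⟨h0, h1⟩ := hM
  refine ⟨e.symm.toEquiv.nontrivial, fun A B hAB => ?_⟩
  have hc : IsCompl (A.comap e.toLinearMap) (B.comap e.toLinearMap) := by
    have := (Submodule.orderIsoMapComap e).symm.isCompl hAB
    simpa using this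
  have key : ∀ A : Submodule R N, A.comap e.toLinearMap = ⊥ → A = ⊥ := by
    intro A hA
    rw [eq_bot_iff]
    intro x hx
    have : e.symm x ∈ A.comap e.toLinearMap := by simpa using hx
    rw [hA] at this
    simpa using this
  exact (h1 _ _ hc).imp (key A) (key B)

theorem IsUniserial.of_surjective (hM : IsUniserial R M) (g : M →ₗ[R] N)
    (hg : Function.Surjective g) : IsUniserial R N := fun A B =>
  (hM (A.comap g) (B.comap g)).imp (Submodule.comap_le_comap_iff_of_surjective hg).1
    (Submodule.comap_le_comap_iff_of_surjective hg).1

theorem IsUniserial.of_injective (hM : IsUniserial R M) (f : N →ₗ[R] M)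
    (hf : Function.Injective f) : IsUniserial R N := fun A B =>
  (hM (A.map f) (B.map f)).imp (Submodule.map_le_map_iff_of_injective hf _ _).1
    (Submodule.map_le_map_iff_of_injective hf _ _).1

/-- In a uniserial module a nonzero map into a quotient of the target detects surjectivity: if
`φ : M → Q` covers a surjection onto a nonzero quotient of `Q`, then `φ` is surjective. -/
theorem IsUniserial.surjective_of_comp_surjective (hQ : IsUniserial R Q) [Nontrivial P]
    (q : Q →ₗ[R] P) (φ : M →ₗ[R] Q) (h : Function.Surjective (q ∘ₗ φ)) :
    Function.Surjective φ := by
  have hsup : ∀ x : Q, ∃ y, x - φ y ∈ LinearMap.ker q := fun x => by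
    obtain ⟨y, hy⟩ := h (q x)
    exact ⟨y, by simpa [sub_eq_zero] using hy.symm⟩
  rcases hQ (LinearMap.range φ) (LinearMap.ker q) with h1 | h1
  · obtain ⟨z, hz⟩ := exists_ne (0 : P)
    obtain ⟨y, rfl⟩ := h z
    exact absurd (h1 ⟨y, rfl⟩) hz
  · intro x
    obtain ⟨y, hy⟩ := hsup x
    obtain ⟨z, hz⟩ := h1 hy
    exact ⟨z + y, by rw [map_add, hz]; abel⟩

end Maps

/-! ### Projective injective coresolutions, not necessarily minimal -/

section DD

/-- Finitely generated projective injective modules. -/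
def IsFinProjInj (R : Type u) [Ring R] (M : Type u) [AddCommGroup M] [Module R M] : Prop :=
  Module.Finite R M ∧ Module.Projective R M ∧ Module.Injective R M

/-- There is an exact sequence `0 → M → I 0 → ⋯ → I (d - 1)` with finitely generated projective
injective terms `I i`. -/
def HasProjInjCoresolution (R : Type u) [Ring R] :
    ℕ → ∀ (M : Type u) [AddCommGroup M] [Module R M], Prop
  | 0, _, _, _ => True
  | d + 1, M, _, _ => ∃ (I N : ModuleCat.{u} R) (f : M →ₗ[R] I) (g : I →ₗ[R] N),
      IsFinProjInj R I ∧ Function.Injective f ∧ Function.Surjective g ∧ Function.Exact f g ∧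
        HasProjInjCoresolution R d N

variable {R : Type u} [Ring R]

theorem HasProjInjCoresolution.mono {d : ℕ} {M : Type u} [AddCommGroup M] [Module R M]
    (h : HasProjInjCoresolution R (d + 1) M) : HasProjInjCoresolution R d M := by
  induction d generalizing M with
  | zero => trivial
  | succ d ih =>
    obtain ⟨I, N, f, g, hI, hf, hg, hfg, hN⟩ := h
    exact ⟨I, N, f, g, hI, hf, hg, hfg, ih hN⟩

theorem HasProjInjCoresolution.mono_le {d e : ℕ} (hde : d ≤ e) {M : Type u} [AddCommGroup M]
    [Module R M] (h : HasProjInjCoresolution R e M) : HasProjInjCoresolution R d M := by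
  induction hde with
  | refl => exact h
  | step _ ih => exact ih h.mono

theorem HasProjInjCoresolution.of_subsingleton (d : ℕ) (M : Type u) [AddCommGroup M] [Module R M]
    [Subsingleton M] : HasProjInjCoresolution R d M := by
  induction d with
  | zero => trivial
  | succ d ih =>
    refine ⟨ModuleCat.of R M, ModuleCat.of R M, LinearMap.id, LinearMap.id,
      ⟨inferInstance, inferInstance, ⟨fun X Y _ _ _ _ f hf g => ⟨0, fun x => Subsingleton.elim _ _⟩⟩⟩,
      Function.injective_id, Function.surjective_id, fun x => ?_, ih⟩
    exact ⟨fun _ => ⟨x, rfl⟩, fun _ => Subsingleton.elim _ _⟩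

theorem IsFinProjInj.prod {M N : Type u} [AddCommGroup M] [Module R M] [AddCommGroup N]
    [Module R N] (hM : IsFinProjInj R M) (hN : IsFinProjInj R N) : IsFinProjInj R (M × N) := by
  obtain ⟨_, _, h1⟩ := hM
  obtain ⟨_, _, h2⟩ := hN
  exact ⟨inferInstance, inferInstance, h1.prod h2⟩

/-- The horseshoe lemma. -/
theorem HasProjInjCoresolution.of_exact {d : ℕ} {X Y Z : Type u} [AddCommGroup X] [Module R X]
    [AddCommGroup Y] [Module R Y] [AddCommGroup Z] [Module R Z] (a : X →ₗ[R] Y) (b : Y →ₗ[R] Z)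
    (ha : Function.Injective a) (hb : Function.Surjective b) (hab : Function.Exact a b)
    (hX : HasProjInjCoresolution R d X) (hZ : HasProjInjCoresolution R d Z) :
    HasProjInjCoresolution R d Y := by
  induction d generalizing X Y Z with
  | zero => trivial
  | succ d ih =>
    obtain ⟨J, X', f, g, hJ, hf, hg, hfg, hX'⟩ := hX
    obtain ⟨J', Z', f', g', hJ', hf', hg', hfg', hZ'⟩ := hZ
    obtain ⟨φ, hφ⟩ := hJ.2.2.out a ha f
    let F : Y →ₗ[R] J × J' := φ.prod (f' ∘ₗ b)
    have hF : ∀ y, F y = (φ y, f' (b y)) := fun _ => rfl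
    have hFa : ∀ x, F (a x) = (f x, 0) := fun x => by
      rw [hF, hφ, (hab (a x)).2 ⟨x, rfl⟩, map_zero]
    let C := (J × J') ⧸ LinearMap.range F
    have hC : ∀ y, (LinearMap.range F).mkQ y = 0 ↔ ∃ z, F z = y := fun y => by
      rw [Submodule.mkQ_apply, Submodule.Quotient.mk_eq_zero]; rfl
    -- `α` and `β` are the induced maps of cokernels `X' → C → Z'`, to which the induction
    -- hypothesis applies.
    obtain ⟨α, hα⟩ := g.exists_factor_of_surjective hg
      ((LinearMap.range F).mkQ ∘ₗ LinearMap.inl R J J') (fun x hx => by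
        obtain ⟨y, rfl⟩ := (hfg x).1 hx
        exact (hC _).2 ⟨a y, hFa y⟩)
    obtain ⟨β, hβ⟩ := (LinearMap.range F).mkQ.exists_factor_of_surjective
      (Submodule.mkQ_surjective _) (g' ∘ₗ LinearMap.snd R J J') (fun x hx => by
        obtain ⟨y, rfl⟩ := (hC _).1 hx
        exact (hfg' _).2 ⟨b y, rfl⟩)
    have key : HasProjInjCoresolution R d C := by
      refine ih α β ?_ ?_ ?_ hX' hZ'
      · rw [injective_iff_map_eq_zero]
        intro x hx
        obtain ⟨j, rfl⟩ := hg x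
        rw [hα] at hx
        obtain ⟨y, hy⟩ := (hC _).1 hx
        have h2 : b y = 0 := hf' (by rw [map_zero]; exact congrArg Prod.snd hy)
        obtain ⟨x, rfl⟩ := (hab y).1 h2
        rw [hFa] at hy
        exact (hfg j).2 ⟨x, congrArg Prod.fst hy⟩
      · intro z
        obtain ⟨j, rfl⟩ := hg' z
        exact ⟨_, hβ (0, j)⟩
      · intro c
        obtain ⟨⟨j, j'⟩, rfl⟩ := Submodule.mkQ_surjective _ c
        rw [hβ]
        constructor
        · intro h
          obtain ⟨z, hz⟩ := (hfg' j').1 h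
          obtain ⟨y, rfl⟩ := hb z
          refine ⟨g (j - φ y), ?_⟩
          rw [hα, ← sub_eq_zero]
          change (LinearMap.range F).mkQ _ - _ = 0
          rw [← map_sub, hC]
          refine ⟨-y, ?_⟩
          rw [map_neg, hF, hz]
          ext <;> simp
        · rintro ⟨x, hx⟩
          obtain ⟨i, rfl⟩ := hg x
          rw [hα, ← sub_eq_zero] at hx
          change (LinearMap.range F).mkQ _ - _ = 0 at hx
          rw [← map_sub, hC] at hx
          obtain ⟨y, hy⟩ := hx
          have : f' (b y) = -j' := by simpa [hF] using congrArg Prod.snd hy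
          change g' j' = 0
          rw [← neg_neg j', ← this, map_neg, (hfg' _).2 ⟨_, rfl⟩, neg_zero]
    refine ⟨ModuleCat.of R (J × J'), ModuleCat.of R C, F, (LinearMap.range F).mkQ, hJ.prod hJ',
      ?_, Submodule.mkQ_surjective _, hC, key⟩
    rw [injective_iff_map_eq_zero]
    intro y hy
    have h2 : b y = 0 := hf' (by rw [map_zero]; exact congrArg Prod.snd hy)
    obtain ⟨x, rfl⟩ := (hab y).1 h2
    rw [hFa] at hy
    rw [hf (by rw [map_zero]; exact congrArg Prod.fst hy : f x = f 0), map_zero]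

/-- The complement `ker p` is again a retract of `M`, so by induction it has a coresolution one step
shorter. Embedding `N` in `I` through `M`, the cokernel is an extension of `C` by `ker p`, and the
horseshoe lemma applies. -/
theorem HasProjInjCoresolution.of_retract {d : ℕ} {M N : Type u} [AddCommGroup M] [Module R M]
    [AddCommGroup N] [Module R N] (i : N →ₗ[R] M) (p : M →ₗ[R] N) (h : ∀ x, p (i x) = x)
    (hM : HasProjInjCoresolution R d M) : HasProjInjCoresolution R d N := by
  induction d generalizing M N with
  | zero => trivial
  | succ d ih =>
    have hM' := hM.mono
    obtain ⟨I, C, f, g, hI, hf, hg, hfg, hC⟩ := hM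
    have hk : HasProjInjCoresolution R d (LinearMap.ker p) := by
      refine ih (LinearMap.ker p).subtype ((LinearMap.id - i ∘ₗ p).codRestrict (LinearMap.ker p)
        (fun x => by simp [h])) (fun x => ?_) hM'
      have : p x.1 = 0 := x.2
      ext
      simp [this]
    have hF : Function.Injective (f ∘ₗ i) := hf.comp (fun x y hxy => by rw [← h x, hxy, h])
    have hE : ∀ y, (LinearMap.range (f ∘ₗ i)).mkQ y = 0 ↔ ∃ z, f (i z) = y := fun y => by
      rw [Submodule.mkQ_apply, Submodule.Quotient.mk_eq_zero]; rfl
    obtain ⟨β, hβ⟩ := (LinearMap.range (f ∘ₗ i)).mkQ.exists_factor_of_surjective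
      (Submodule.mkQ_surjective _) g (fun x hx => by
        obtain ⟨y, rfl⟩ := (hE _).1 hx
        exact (hfg _).2 ⟨i y, rfl⟩)
    have hEd : HasProjInjCoresolution R d (I ⧸ LinearMap.range (f ∘ₗ i)) := by
      refine of_exact ((LinearMap.range (f ∘ₗ i)).mkQ ∘ₗ f ∘ₗ (LinearMap.ker p).subtype) β
        ?_ ?_ ?_ hk hC
      · rw [injective_iff_map_eq_zero]
        rintro ⟨x, hx⟩ hx'
        obtain ⟨z, hz⟩ := (hE _).1 hx'
        have hz' : i z = x := hf hz
        have : p x = 0 := hx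
        rw [← hz', h] at this
        ext
        change x = 0
        rw [← hz', this, map_zero]
      · intro c
        obtain ⟨x, rfl⟩ := hg c
        exact ⟨_, hβ x⟩
      · intro c
        obtain ⟨x, rfl⟩ := Submodule.mkQ_surjective _ c
        rw [hβ]
        constructor
        · intro hx
          obtain ⟨m, rfl⟩ := (hfg x).1 hx
          refine ⟨⟨m - i (p m), by simp [h]⟩, ?_⟩
          change (LinearMap.range (f ∘ₗ i)).mkQ (f (m - i (p m))) = _
          rw [← sub_eq_zero, ← map_sub, hE]
          exact ⟨-p m, by simp⟩
        · rintro ⟨⟨y, hy⟩, hx⟩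
          change (LinearMap.range (f ∘ₗ i)).mkQ (f y) = _ at hx
          rw [← hβ, ← hx, hβ]
          exact (hfg _).2 ⟨y, rfl⟩
    exact ⟨I, ModuleCat.of R _, f ∘ₗ i, (LinearMap.range (f ∘ₗ i)).mkQ, hI, hF,
      Submodule.mkQ_surjective _, hE, hEd⟩

theorem HasProjInjCoresolution.prod {d : ℕ} {M N : Type u} [AddCommGroup M] [Module R M]
    [AddCommGroup N] [Module R N] (hM : HasProjInjCoresolution R d M)
    (hN : HasProjInjCoresolution R d N) : HasProjInjCoresolution R d (M × N) :=
  of_exact (LinearMap.inl R M N) (LinearMap.snd R M N) LinearMap.inl_injective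
    LinearMap.snd_surjective Function.Exact.inl_snd hM hN

end DD

/-! ### Decompositions, covers and hulls over artinian rings -/

section Artinian

variable {R : Type u} [Ring R]

/-- Finitely generated modules over an artinian ring are finite direct sums of indecomposables. -/
theorem indecomposable_induction [IsArtinianRing R] {Q : ModuleCat.{u} R → Prop}
    (equiv : ∀ M N : ModuleCat.{u} R, (M ≃ₗ[R] N) → Q M → Q N)
    (zero : ∀ M : ModuleCat.{u} R, Subsingleton M → Q M)
    (indec : ∀ M : ModuleCat.{u} R, Module.Finite R M → IsIndecomposable R M → Q M)
    (prod : ∀ M N : ModuleCat.{u} R, Q M → Q N → Q (ModuleCat.of R (M × N)))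
    (M : ModuleCat.{u} R) (hM : Module.Finite R M) : Q M := by
  induction h : Module.length R M using WellFoundedLT.induction generalizing M with
  | ind l ih =>
    rcases subsingleton_or_nontrivial M with h0 | h0
    · exact zero M h0
    by_cases hi : IsIndecomposable R M
    · exact indec M hM hi
    · have : ∃ N N' : Submodule R M, IsCompl N N' ∧ N ≠ ⊥ ∧ N' ≠ ⊥ := by
        by_contra! hc
        exact hi ⟨h0, fun N N' hN => or_iff_not_imp_left.2 (hc N N' hN)⟩
      obtain ⟨N, N', hc, hN, hN'⟩ := this
      have h1 : N ≠ ⊤ := fun h => hN' (by simpa [h] using hc.inf_eq_bot)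
      have h2 : N' ≠ ⊤ := fun h => hN (by simpa [h] using hc.inf_eq_bot)
      refine equiv (ModuleCat.of R (N × N')) M (Submodule.prodEquivOfIsCompl N N' hc)
        (prod (ModuleCat.of R N) (ModuleCat.of R N') ?_ ?_)
      · exact ih _ (h ▸ Submodule.length_lt h1) (ModuleCat.of R N) inferInstance rfl
      · exact ih _ (h ▸ Submodule.length_lt h2) (ModuleCat.of R N') inferInstance rfl

section Uniqueness

variable {M N P Q : Type u} [AddCommGroup M] [Module R M]
  [AddCommGroup N] [Module R N] [AddCommGroup P] [Module R P] [AddCommGroup Q] [Module R Q]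

/-- Fitting's lemma for an endomorphism with a nonzero fixed point. -/
theorem IsIndecomposable.bijective_of_fixed [IsArtinian R M] [IsNoetherian R M]
    (hM : IsIndecomposable R M) (φ : M →ₗ[R] M) {x : M} (hx : x ≠ 0) (h : φ x = x) :
    Function.Bijective φ := by
  -- A positive exponent ensures `ker φ ≤ ker (φ ^ n)`.
  obtain ⟨n, hn, hn1⟩ := (φ.eventually_isCompl_ker_pow_range_pow.and
    (Filter.eventually_ge_atTop 1)).exists
  have hfix : ∀ k : ℕ, (φ ^ k) x = x := fun k => by
    induction k with
    | zero => rfl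
    | succ k ih => rw [pow_succ, Module.End.mul_apply, h, ih]
  rcases hM.2 _ _ hn with h0 | h0
  · apply IsArtinian.bijective_of_injective_endomorphism
    rw [injective_iff_map_eq_zero]
    intro y hy
    obtain ⟨k, rfl⟩ : ∃ k, n = k + 1 := ⟨n - 1, by omega⟩
    have : y ∈ LinearMap.ker (φ ^ (k + 1)) := by
      rw [LinearMap.mem_ker, pow_succ, Module.End.mul_apply, hy, map_zero]
    rw [h0] at this
    simpa using this
  · have : x ∈ LinearMap.range (φ ^ n) := ⟨x, hfix n⟩
    rw [h0] at this
    exact absurd (by simpa using this) hx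

/-- A lift `P → Q` is surjective because `Q` is uniserial; it then splits, and indecomposability of
`P` makes it bijective. -/
theorem nonempty_equiv_of_projective_covers [Nontrivial M] (hP : IsIndecomposable R P)
    (hPp : Module.Projective R P) (hQ : Module.Projective R Q) [Nontrivial Q]
    (hQu : IsUniserial R Q) (p : P →ₗ[R] M) (hp : Function.Surjective p) (q : Q →ₗ[R] M)
    (hq : Function.Surjective q) : Nonempty (P ≃ₗ[R] Q) := by
  obtain ⟨φ, hφ⟩ := Module.projective_lifting_property q p hq
  have hs : Function.Surjective φ := hQu.surjective_of_comp_surjective q φ (by rwa [hφ])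
  obtain ⟨s, hs⟩ := hQ.exists_section φ hs
  exact ⟨LinearEquiv.ofBijective φ (hP.bijective_of_retract s φ hs)⟩

/-- Extend the embeddings in both directions; both composites fix a nonzero element coming from `M`,
so Fitting's lemma makes them bijective. -/
theorem nonempty_equiv_of_injective_hulls [IsArtinian R P] [IsNoetherian R P] [IsArtinian R Q]
    [IsNoetherian R Q] [Nontrivial M] (hP : IsIndecomposable R P)
    (hPi : Module.Injective R P) (hQ : IsIndecomposable R Q) (hQi : Module.Injective R Q)
    (p : M →ₗ[R] P) (hp : Function.Injective p) (q : M →ₗ[R] Q)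
    (hq : Function.Injective q) : Nonempty (P ≃ₗ[R] Q) := by
  obtain ⟨φ, hφ⟩ := hQi.out p hp q
  obtain ⟨ψ, hψ⟩ := hPi.out q hq p
  obtain ⟨x, hx⟩ := exists_ne (0 : M)
  have h1 := hP.bijective_of_fixed (ψ ∘ₗ φ) (x := p x) (by simpa [hp.eq_iff' (map_zero p)] using hx)
    (by simp [hφ, hψ])
  have h2 := hQ.bijective_of_fixed (φ ∘ₗ ψ) (x := q x) (by simpa [hq.eq_iff' (map_zero q)] using hx)
    (by simp [hφ, hψ])
  exact ⟨LinearEquiv.ofBijective φ ⟨Function.Injective.of_comp (f := ψ) h1.1,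
    Function.Surjective.of_comp (g := ψ) h2.2⟩⟩

end Uniqueness

theorem exists_simple_quotient (M : Type u) [AddCommGroup M] [Module R M] [Module.Finite R M]
    [Nontrivial M] : ∃ (S : ModuleCat.{u} R) (f : M →ₗ[R] S), IsSimpleModule R S ∧
      Function.Surjective f := by
  obtain ⟨N, hN, -⟩ := (eq_top_or_exists_le_coatom (⊥ : Submodule R M)).resolve_left bot_ne_top
  exact ⟨ModuleCat.of R (M ⧸ N), N.mkQ, isSimpleModule_iff_isCoatom.2 hN, N.mkQ_surjective⟩

theorem exists_simple_submodule (M : Type u) [AddCommGroup M] [Module R M] [IsArtinian R M]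
    [Nontrivial M] : ∃ (S : ModuleCat.{u} R) (f : S →ₗ[R] M), IsSimpleModule R S ∧
      Function.Injective f := by
  obtain ⟨N, hN, -⟩ := (eq_bot_or_exists_atom_le (⊤ : Submodule R M)).resolve_left top_ne_bot
  exact ⟨ModuleCat.of R N, N.subtype, isSimpleModule_iff_isAtom.2 hN, N.injective_subtype⟩

/-- A nonzero map to `S` from a direct sum is nonzero on some indecomposable summand; this is
applied to the regular module. -/
theorem exists_indecomposable_projective_cover [IsArtinianRing R] (S : Type u) [AddCommGroup S]
    [Module R S] [IsSimpleModule R S] :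
    ∃ (P : ModuleCat.{u} R) (f : P →ₗ[R] S), Module.Finite R P ∧ IsIndecomposable R P ∧
      Module.Projective R P ∧ Function.Surjective f := by
  have key : ∀ M : ModuleCat.{u} R, Module.Finite R M → Module.Projective R M →
      ∀ q : M →ₗ[R] S, q ≠ 0 → ∃ (P : ModuleCat.{u} R) (f : P →ₗ[R] S), Module.Finite R P ∧
        IsIndecomposable R P ∧ Module.Projective R P ∧ Function.Surjective f := by
    refine indecomposable_induction ?_ ?_ ?_ ?_
    · intro M N e h hN q hq
      exact h (hN.of_equiv e.symm) (q ∘ₗ e.toLinearMap) fun h0 => hq <| by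
        ext x
        simpa using LinearMap.congr_fun h0 (e.symm x)
    · intro M _ _ q hq
      exact absurd (LinearMap.ext fun x => by rw [Subsingleton.elim x 0, map_zero, map_zero]) hq
    · intro M hf hi hp q hq
      exact ⟨M, q, hf, hi, hp, LinearMap.surjective_of_ne_zero hq⟩
    · intro M N hM hN hp q hq
      by_cases h : q ∘ₗ LinearMap.inl R M N = 0
      · refine hN (hp.of_retract (LinearMap.inr R M N) (LinearMap.snd R M N) fun _ => rfl)
          (q ∘ₗ LinearMap.inr R M N) fun h' => hq (LinearMap.prod_ext ?_ ?_)
        · rw [h]; rfl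
        · rw [h']; rfl
      · exact hM (hp.of_retract (LinearMap.inl R M N) (LinearMap.fst R M N) fun _ => rfl) _ h
  have : Nontrivial S := IsSimpleModule.nontrivial R S
  obtain ⟨x, hx⟩ := exists_ne (0 : S)
  exact key (ModuleCat.of R R) inferInstance inferInstance (LinearMap.toSpanSingleton R S x)
    fun h => hx (by simpa using LinearMap.congr_fun h 1)

theorem projective_of_injective [IsArtinianRing R]
    (h : ∀ J : ModuleCat.{u} R, Module.Finite R J → IsIndecomposable R J → Module.Injective R J →
      Module.Projective R J) (M : Type u) [AddCommGroup M] [Module R M] [hM : Module.Finite R M]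
    (hi : Module.Injective R M) : Module.Projective R M := by
  refine indecomposable_induction (Q := fun M => Module.Injective R M → Module.Projective R M)
    ?_ ?_ h ?_ (ModuleCat.of R M) hM hi
  · intro M N e hM hN
    exact (hM (hN.of_retract e.toLinearMap e.symm.toLinearMap (by simp))).of_equiv e
  · intro M _ _
    have := Module.Free.of_subsingleton R M
    exact Module.Projective.of_free
  · intro M N hM hN hMN
    have := hM (hMN.of_retract (LinearMap.inl R M N) (LinearMap.fst R M N) fun _ => rfl)
    have := hN (hMN.of_retract (LinearMap.inr R M N) (LinearMap.snd R M N) fun _ => rfl)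
    exact inferInstanceAs (Module.Projective R (M × N))

theorem injective_of_projective [IsArtinianRing R]
    (h : ∀ J : ModuleCat.{u} R, Module.Finite R J → IsIndecomposable R J → Module.Projective R J →
      Module.Injective R J) (M : Type u) [AddCommGroup M] [Module R M] [hM : Module.Finite R M]
    (hi : Module.Projective R M) : Module.Injective R M := by
  refine indecomposable_induction (Q := fun M => Module.Projective R M → Module.Injective R M)
    ?_ ?_ h ?_ (ModuleCat.of R M) hM hi
  · intro M N e hM hN
    exact (hM (hN.of_equiv e.symm)).of_retract e.symm.toLinearMap e.toLinearMap (by simp)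
  · intro M _ _
    exact ⟨fun X Y _ _ _ _ f hf g => ⟨0, fun x => Subsingleton.elim _ _⟩⟩
  · intro M N hM hN hMN
    exact (hM (hMN.of_retract (LinearMap.inl R M N) (LinearMap.fst R M N) fun _ => rfl)).prod
      (hN (hMN.of_retract (LinearMap.inr R M N) (LinearMap.snd R M N) fun _ => rfl))

/-- A nonzero uniserial submodule of a projective injective module embeds in an indecomposable
summand. -/
theorem exists_indecomposable_retract [IsArtinianRing R] {M I : Type u} [AddCommGroup M]
    [Module R M] [AddCommGroup I] [Module R I] [Nontrivial M] (hM : IsUniserial R M)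
    (hI : IsFinProjInj R I) (f : M →ₗ[R] I) (hf : Function.Injective f) :
    ∃ (J : ModuleCat.{u} R) (i : J →ₗ[R] I) (p : I →ₗ[R] J), IsIndecomposable R J ∧
      (∀ x, p (i x) = x) ∧ Function.Injective (p ∘ₗ f) := by
  refine indecomposable_induction (R := R) (Q := fun I => ∀ f : M →ₗ[R] I, Function.Injective f →
    ∃ (J : ModuleCat.{u} R) (i : J →ₗ[R] I) (p : I →ₗ[R] J), IsIndecomposable R J ∧
      (∀ x, p (i x) = x) ∧ Function.Injective (p ∘ₗ f)) ?_ ?_ ?_ ?_ (ModuleCat.of R I) hI.1 f hf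
  · intro I I' e h f hf
    obtain ⟨J, i, p, hJ, hip, hpf⟩ := h (e.symm.toLinearMap ∘ₗ f) (e.symm.injective.comp hf)
    exact ⟨J, e.toLinearMap ∘ₗ i, p ∘ₗ e.symm.toLinearMap, hJ, by simpa using hip, hpf⟩
  · intro I _ f hf
    obtain ⟨x, hx⟩ := exists_ne (0 : M)
    exact absurd (hf (Subsingleton.elim _ _)) hx
  · intro I _ hI f hf
    exact ⟨I, LinearMap.id, LinearMap.id, hI, fun _ => rfl, hf⟩
  · intro I I' h h' f hf
    -- The kernels of the two components meet in zero and are nested by uniseriality, so one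
    -- component is already injective.
    have hinf : LinearMap.ker (LinearMap.fst R I I' ∘ₗ f) ⊓
        LinearMap.ker (LinearMap.snd R I I' ∘ₗ f) = ⊥ := by
      rw [eq_bot_iff]
      rintro x ⟨h1, h2⟩
      exact hf (by rw [map_zero]; exact Prod.ext h1 h2)
    rcases hM (LinearMap.ker (LinearMap.fst R I I' ∘ₗ f))
      (LinearMap.ker (LinearMap.snd R I I' ∘ₗ f)) with hle | hle
    · rw [inf_eq_left.2 hle] at hinf
      obtain ⟨J, i, p, hJ, hip, hpf⟩ := h _ (LinearMap.ker_eq_bot.1 hinf)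
      exact ⟨J, LinearMap.inl R I I' ∘ₗ i, p ∘ₗ LinearMap.fst R I I', hJ, hip, hpf⟩
    · rw [inf_eq_right.2 hle] at hinf
      obtain ⟨J, i, p, hJ, hip, hpf⟩ := h' _ (LinearMap.ker_eq_bot.1 hinf)
      exact ⟨J, LinearMap.inr R I I' ∘ₗ i, p ∘ₗ LinearMap.snd R I I', hJ, hip, hpf⟩

theorem HasProjInjCoresolution.of_exact_injective {d : ℕ} {X Y Z : Type u} [AddCommGroup X]
    [Module R X] [AddCommGroup Y] [Module R Y] [AddCommGroup Z] [Module R Z] (a : X →ₗ[R] Y)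
    (b : Y →ₗ[R] Z) (ha : Function.Injective a) (hb : Function.Surjective b)
    (hab : Function.Exact a b) (hX : Module.Injective R X)
    (hY : HasProjInjCoresolution R d Y) : HasProjInjCoresolution R d Z := by
  obtain ⟨ρ, hρ⟩ := hX.exists_retraction a ha
  obtain ⟨s, hs⟩ := b.exists_factor_of_surjective hb (LinearMap.id - a ∘ₗ ρ) fun y hy => by
    obtain ⟨x, rfl⟩ := (hab y).1 hy
    simp [hρ]
  refine hY.of_retract s b fun z => ?_
  obtain ⟨y, rfl⟩ := hb z
  simp [hs, (hab (a (ρ y))).2 ⟨_, rfl⟩]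

/-- A projective injective coresolution of a uniserial module can be chosen to start with an
indecomposable module. -/
theorem HasProjInjCoresolution.exists_indecomposable [IsArtinianRing R] {d : ℕ} {M : Type u}
    [AddCommGroup M] [Module R M] [Nontrivial M] (hM : IsUniserial R M)
    (h : HasProjInjCoresolution R (d + 1) M) :
    ∃ (J N : ModuleCat.{u} R) (f : M →ₗ[R] J) (g : J →ₗ[R] N), IsFinProjInj R J ∧
      IsIndecomposable R J ∧ Function.Injective f ∧ Function.Surjective g ∧
        Function.Exact f g ∧ HasProjInjCoresolution R d N := by
  obtain ⟨I, C, f, g, hI, hf, hg, hfg, hC⟩ := h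
  obtain ⟨J, i, p, hJ, hip, hpf⟩ := exists_indecomposable_retract hM hI f hf
  have hJ' : IsFinProjInj R J := by
    have := hI.1
    exact ⟨Module.Finite.of_surjective p fun x => ⟨i x, hip x⟩, hI.2.1.of_retract i p hip,
      hI.2.2.of_retract i p hip⟩
  have hker : Module.Injective R (LinearMap.ker p) :=
    hI.2.2.of_retract (LinearMap.ker p).subtype ((LinearMap.id - i ∘ₗ p).codRestrict
      (LinearMap.ker p) (fun x => by simp [hip])) fun x => by
        have : p x.1 = 0 := x.2
        ext
        simp [this]
  have hE : ∀ y, (LinearMap.range (p ∘ₗ f)).mkQ y = 0 ↔ ∃ z, p (f z) = y := fun y => by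
    rw [Submodule.mkQ_apply, Submodule.Quotient.mk_eq_zero]; rfl
  obtain ⟨β, hβ⟩ := g.exists_factor_of_surjective hg ((LinearMap.range (p ∘ₗ f)).mkQ ∘ₗ p)
    fun x hx => by
      obtain ⟨m, rfl⟩ := (hfg x).1 hx
      exact (hE _).2 ⟨m, rfl⟩
  refine ⟨J, ModuleCat.of R (J ⧸ LinearMap.range (p ∘ₗ f)), p ∘ₗ f,
    (LinearMap.range (p ∘ₗ f)).mkQ, hJ', hJ, hpf, Submodule.mkQ_surjective _, hE, ?_⟩
  -- The sequence `0 → ker p → C → J / M → 0` is exact with `ker p` injective, so the new cokernel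
  -- is a retract of `C`.
  refine hC.of_exact_injective (g ∘ₗ (LinearMap.ker p).subtype) β ?_ ?_ ?_ hker
  · rw [injective_iff_map_eq_zero]
    rintro ⟨x, hx⟩ hx'
    obtain ⟨m, rfl⟩ := (hfg x).1 hx'
    have hm : m = 0 := hpf (by rw [map_zero]; exact hx)
    ext
    simp [hm]
  · intro y
    obtain ⟨y, rfl⟩ := Submodule.mkQ_surjective _ y
    exact ⟨g (i y), by rw [hβ]; simp [hip]⟩
  · intro c
    obtain ⟨x, rfl⟩ := hg c
    rw [hβ]
    constructor
    · intro hx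
      obtain ⟨m, hm⟩ := (hE _).1 hx
      refine ⟨⟨x - f m, by simp [hm]⟩, ?_⟩
      simp [(hfg (f m)).2 ⟨m, rfl⟩]
    · rintro ⟨⟨y, hy⟩, hx⟩
      change g y = g x at hx
      have hy' : p y = 0 := hy
      have h1 := hβ y
      rw [hx, hβ] at h1
      rw [h1]
      simp [hy']

end Artinian

/-! ### Cosyzygies and their projective covers -/

section Cosyzygy

/-- Finitely generated indecomposable projective modules. -/
def IsIndecProj (R : Type u) [Ring R] (M : ModuleCat.{u} R) : Prop :=
  Module.Finite R M ∧ IsIndecomposable R M ∧ Module.Projective R M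

/-- `IsCosyzygy R P k M Q`: the module `M` is a nonzero `k`-th cosyzygy of `P` with respect to
indecomposable projective injective modules, and `Q` is its projective cover, i.e. `P` for `k = 0`
and the last term of the coresolution for `k > 0`. -/
inductive IsCosyzygy (R : Type u) [Ring R] (P : ModuleCat.{u} R) :
    ℕ → ModuleCat.{u} R → ModuleCat.{u} R → Prop
  | zero : IsCosyzygy R P 0 P P
  | succ {k : ℕ} {M Q I N : ModuleCat.{u} R} (f : M →ₗ[R] I) (g : I →ₗ[R] N) :
      IsCosyzygy R P k M Q → IsFinProjInj R I → IsIndecomposable R I → Function.Injective f →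
        Function.Surjective g → Function.Exact f g → Nontrivial N → IsCosyzygy R P (k + 1) N I

variable {R : Type u} [Ring R]

theorem IsIndecProj.isUniserial (hR : IsLeftSerial R) {P : ModuleCat.{u} R}
    (h : IsIndecProj R P) : IsUniserial R P :=
  hR P h.1 h.2.2 h.2.1

theorem IsIndecProjNonInj.isIndecProj {P : ModuleCat.{u} R} (h : IsIndecProjNonInj R P) :
    IsIndecProj R P :=
  ⟨h.1, h.2.1, h.2.2.1⟩

theorem IsCosyzygy.isIndecProj {P M Q : ModuleCat.{u} R} {k : ℕ} (hP : IsIndecProj R P)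
    (h : IsCosyzygy R P k M Q) : IsIndecProj R Q := by
  cases h with
  | zero => exact hP
  | succ f g _ hI hI' => exact ⟨hI.1, hI', hI.2.1⟩

theorem IsCosyzygy.exists_surjective {P M Q : ModuleCat.{u} R} {k : ℕ}
    (h : IsCosyzygy R P k M Q) : ∃ q : Q →ₗ[R] M, Function.Surjective q := by
  cases h with
  | zero => exact ⟨LinearMap.id, Function.surjective_id⟩
  | succ f g _ _ _ _ hg => exact ⟨g, hg⟩

theorem IsCosyzygy.nontrivial {P M Q : ModuleCat.{u} R} {k : ℕ} (hP : IsIndecProj R P)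
    (h : IsCosyzygy R P k M Q) : Nontrivial M := by
  cases h with
  | zero => exact hP.2.1.1
  | succ f g _ _ _ _ _ _ h => exact h

/-- Not being projective injective is the invariant that keeps cosyzygies nonzero. If the next one
vanished, the current one would be isomorphic to `J`; if the next one were projective, `J → N` would
split, hence be bijective, and the current one would vanish. -/
theorem IsCosyzygy.exists_of_hasProjInjCoresolution [IsArtinianRing R] (hR : IsLeftSerial R)
    {P : ModuleCat.{u} R} (hP : IsIndecProjNonInj R P) (k e : ℕ)
    (h : HasProjInjCoresolution R (k + e) P) :
    ∃ M Q : ModuleCat.{u} R, IsCosyzygy R P k M Q ∧ HasProjInjCoresolution R e M ∧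
      IsUniserial R M ∧ ¬ IsFinProjInj R M := by
  induction k generalizing e with
  | zero =>
    refine ⟨P, P, .zero, by simpa using h, hP.isIndecProj.isUniserial hR, fun h => hP.2.2.2 h.2.2⟩
  | succ k ih =>
    obtain ⟨M, Q, hM, hd, hu, hn⟩ := ih (e + 1) (by rwa [show k + (e + 1) = k + 1 + e by omega])
    have hM0 := hM.nontrivial hP.isIndecProj
    obtain ⟨J, N, f, g, hJ, hJi, hf, hg, hfg, hN⟩ := hd.exists_indecomposable hu
    have hJu : IsUniserial R J := hR J hJ.1 hJ.2.1 hJi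
    have hker : ∀ s : N →ₗ[R] J, (∀ x, g (s x) = x) → Subsingleton N := fun s hs => by
      by_contra hns
      rw [not_subsingleton_iff_nontrivial] at hns
      have hb := hJi.bijective_of_retract s g hs
      obtain ⟨x, hx⟩ := exists_ne (0 : M)
      exact hx (hf (hb.1 (by simp [(hfg (f x)).2 ⟨x, rfl⟩])))
    have hN0 : Nontrivial N := by
      by_contra hN0
      rw [not_nontrivial_iff_subsingleton] at hN0
      have e : M ≃ₗ[R] J := LinearEquiv.ofBijective f
        ⟨hf, fun x => (hfg x).1 (Subsingleton.elim _ _)⟩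
      have := hJ.1
      exact hn ⟨Module.Finite.equiv e.symm, hJ.2.1.of_equiv e.symm,
        hJ.2.2.of_retract e.toLinearMap e.symm.toLinearMap (by simp)⟩
    refine ⟨N, J, .succ f g hM hJ hJi hf hg hfg hN0, hN, hJu.of_surjective g hg, fun hNp => ?_⟩
    obtain ⟨s, hs⟩ := hNp.2.1.exists_section g hg
    exact not_subsingleton_iff_nontrivial.2 hN0 (hker s hs)

/-- If `N` and `N'` embed compatibly in a module, one inside the other, then the first syzygy of the
smaller one maps onto that of the larger one. -/
theorem exists_surjective_of_syzygies {M I N M' I' N' J J' : Type u} [AddCommGroup M] [Module R M]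
    [AddCommGroup I] [Module R I] [AddCommGroup N] [Module R N] [AddCommGroup M'] [Module R M']
    [AddCommGroup I'] [Module R I'] [AddCommGroup N'] [Module R N'] [AddCommGroup J] [Module R J]
    [AddCommGroup J'] [Module R J'] [Nontrivial N] (hI : Module.Projective R I)
    (hI' : IsUniserial R I') (f : M →ₗ[R] I) (g : I →ₗ[R] N) (f' : M' →ₗ[R] I') (g' : I' →ₗ[R] N')
    (hf' : Function.Injective f') (hg : Function.Surjective g)
    (hg' : Function.Surjective g') (hfg : Function.Exact f g) (hfg' : Function.Exact f' g')
    (a : N →ₗ[R] J) (a' : N' →ₗ[R] J') (e : J ≃ₗ[R] J') (ha : Function.Injective a)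
    (ha' : Function.Injective a')
    (hle : LinearMap.range (e.toLinearMap ∘ₗ a) ≤ LinearMap.range a') :
    ∃ ψ : M →ₗ[R] M', Function.Surjective ψ := by
  obtain ⟨h, hh⟩ := a'.exists_factor_of_injective ha' _ hle
  have hinj : ∀ x, h x = 0 → x = 0 := fun x hx => by
    have := hh x
    rw [hx, map_zero] at this
    exact ha (by rw [map_zero]; exact e.injective (by rw [map_zero]; exact this.symm))
  obtain ⟨φ, hφ⟩ := Module.projective_lifting_property g' (h ∘ₗ g) hg'
  replace hφ : ∀ x, g' (φ x) = h (g x) := fun x => LinearMap.congr_fun hφ x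
  obtain ⟨ψ, hψ⟩ := f'.exists_factor_of_injective hf' (φ ∘ₗ f) (by
    rintro _ ⟨x, rfl⟩
    refine (hfg' _).1 ?_
    simp [hφ, (hfg (f x)).2 ⟨x, rfl⟩])
  refine ⟨ψ, fun m' => ?_⟩
  -- If `φ` landed in `ker g'`, the injection `h` would kill `N ≠ 0`. Otherwise every element of
  -- `M'` has a preimage under `φ`, which lies in `M` because `h` is injective.
  rcases hI' (LinearMap.range φ) (LinearMap.range f') with hle | hle
  · obtain ⟨y, hy⟩ := exists_ne (0 : N)
    obtain ⟨x, rfl⟩ := hg y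
    refine absurd (hinj _ ?_) hy
    rw [← hφ]
    exact (hfg' _).2 (hle ⟨x, rfl⟩)
  · obtain ⟨x, hx⟩ := hle ⟨m', rfl⟩
    have : g x = 0 := hinj _ (by rw [← hφ, hx]; exact (hfg' _).2 ⟨m', rfl⟩)
    obtain ⟨m, rfl⟩ := (hfg x).1 this
    exact ⟨m, hf' (by rw [hψ]; exact hx)⟩

/-- The projective cover of a cosyzygy determines the projective cover two steps before. -/
theorem IsCosyzygy.nonempty_equiv_of_add_two (hR : IsLeftSerial R)
    {P P' M M' Q Q' : ModuleCat.{u} R} (hP : IsIndecProj R P) (hP' : IsIndecProj R P') {k l : ℕ}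
    (h : IsCosyzygy R P (k + 2) M Q) (h' : IsCosyzygy R P' (l + 2) M' Q') (e : Q ≃ₗ[R] Q') :
    ∃ N T N' T' : ModuleCat.{u} R, IsCosyzygy R P k N T ∧ IsCosyzygy R P' l N' T' ∧
      Nonempty (T ≃ₗ[R] T') := by
  cases h with | succ a b h hQ hQi ha hb hab hM =>
  cases h' with | succ a' b' h' hQ' hQi' ha' hb' hab' hM' =>
  have hQu : IsUniserial R Q' := hR Q' hQ'.1 hQ'.2.1 hQi'
  cases h with | @succ _ N T _ _ f g h hI hIi hf hg hfg hX =>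
  cases h' with | @succ _ N' T' _ _ f' g' h' hI' hIi' hf' hg' hfg' hX' =>
  refine ⟨N, T, N', T', h, h', ?_⟩
  obtain ⟨q, hq⟩ := h.exists_surjective
  obtain ⟨q', hq'⟩ := h'.exists_surjective
  have hT := h.isIndecProj hP
  have hT' := h'.isIndecProj hP'
  have := h.nontrivial hP
  have := h'.nontrivial hP'
  have := hT.2.1.1
  have := hT'.2.1.1
  -- The intermediate cosyzygies are nested in `Q'`, so one of `N`, `N'` maps onto the other and
  -- `T`, `T'` both cover the latter.
  rcases hQu (LinearMap.range (e.toLinearMap ∘ₗ a)) (LinearMap.range a') with hle | hle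
  · obtain ⟨ψ, hψ⟩ := exists_surjective_of_syzygies hI.2.1 (hR _ hI'.1 hI'.2.1 hIi') f g f' g' hf'
      hg hg' hfg hfg' a a' e ha ha' hle
    exact nonempty_equiv_of_projective_covers hT.2.1 hT.2.2 hT'.2.2 (hT'.isUniserial hR)
      (ψ ∘ₗ q) (hψ.comp hq) q' hq'
  · have hle' : LinearMap.range (e.symm.toLinearMap ∘ₗ a') ≤ LinearMap.range a := by
      rintro _ ⟨x, rfl⟩
      obtain ⟨y, hy⟩ := hle ⟨x, rfl⟩
      exact ⟨y, by simp [← hy]⟩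
    obtain ⟨ψ, hψ⟩ := exists_surjective_of_syzygies hI'.2.1 (hR _ hI.1 hI.2.1 hIi) f' g' f g hf
      hg' hg hfg' hfg a' a e.symm ha' ha hle'
    exact nonempty_equiv_of_projective_covers hT.2.1 hT.2.2 hT'.2.2 (hT'.isUniserial hR)
      q hq (ψ ∘ₗ q') (hψ.comp hq')

theorem IsCosyzygy.eq_of_even (hR : IsLeftSerial R) {P P' M M' Q Q' : ModuleCat.{u} R}
    (hP : IsIndecProjNonInj R P) (hP' : IsIndecProjNonInj R P') {k l : ℕ}
    (h : IsCosyzygy R P k M Q) (h' : IsCosyzygy R P' (2 * l) M' Q') (e : Q ≃ₗ[R] Q')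
    (hkl : 2 * l ≤ k) : Nonempty (P ≃ₗ[R] P') ∧ k = 2 * l := by
  induction l generalizing k M M' Q Q' with
  | zero =>
    cases h' with | zero =>
    cases h with
    | zero => exact ⟨⟨e⟩, rfl⟩
    | succ f g _ hI =>
      exact absurd (hI.2.2.of_retract e.symm.toLinearMap e.toLinearMap (by simp)) hP'.2.2.2
  | succ l ih =>
    obtain ⟨k, rfl⟩ : ∃ j, k = j + 2 := ⟨k - 2, by omega⟩
    obtain ⟨N, T, N', T', hN, hN', ⟨e'⟩⟩ :=
      h.nonempty_equiv_of_add_two (l := 2 * l) hR hP.isIndecProj hP'.isIndecProj h' e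
    obtain ⟨h1, h2⟩ := ih hN hN' e' (by omega)
    exact ⟨h1, by omega⟩

end Cosyzygy

/-! ### Counting isomorphism classes -/

section Counting

variable {R : Type u} [Ring R]

namespace IsoClasses

variable {p q : ModuleCat.{u} R → Prop}

/-- The isomorphism class of a module. -/
def mk (M : ModuleCat.{u} R) (h : p M) : IsoClasses R p :=
  Quotient.mk (isoSetoid R p) ⟨M, h⟩

/-- A representative of an isomorphism class. -/
noncomputable def out (c : IsoClasses R p) : ModuleCat.{u} R :=
  (Quotient.out (s := isoSetoid R p) c).1

theorem out_prop (c : IsoClasses R p) : p c.out :=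
  (Quotient.out (s := isoSetoid R p) c).2

theorem mk_out (c : IsoClasses R p) : mk c.out c.out_prop = c :=
  Quotient.out_eq (s := isoSetoid R p) c

theorem mk_eq_mk {M N : ModuleCat.{u} R} {hM : p M} {hN : p N} :
    mk M hM = mk N hN ↔ Nonempty (M ≃ₗ[R] N) :=
  Quotient.eq (r := isoSetoid R p)

theorem eq_of_equiv {c c' : IsoClasses R p} (h : Nonempty (c.out ≃ₗ[R] c'.out)) : c = c' := by
  rw [← mk_out c, ← mk_out c', mk_eq_mk]
  exact h

theorem domDim_eq (c : IsoClasses R p) : c.domDim = _root_.domDim R c.out := by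
  conv_lhs => rw [← mk_out c]
  rfl

theorem card_le_of_family {ι : Type*} (f : ι → ModuleCat.{u} R) (hf : ∀ i, q (f i))
    (hinj : ∀ i j, Nonempty (f i ≃ₗ[R] f j) → i = j) :
    ENat.card ι ≤ ENat.card (IsoClasses R q) :=
  ENat.card_le_card_of_injective (f := fun i => mk (f i) (hf i)) fun _ _ h =>
    hinj _ _ (mk_eq_mk.1 h)

end IsoClasses

/-- Indecomposable projective modules are determined by their simple quotients. -/
theorem card_indecProj_le_numSimples (hR : IsLeftSerial R) :
    ENat.card (IsoClasses R (IsIndecProj R)) ≤ numSimples R := by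
  have h (c : IsoClasses R (IsIndecProj R)) : ∃ (S : ModuleCat.{u} R) (f : c.out →ₗ[R] S),
      IsSimpleModule R S ∧ Function.Surjective f := by
    have := c.out_prop.1
    have := c.out_prop.2.1.1
    exact exists_simple_quotient c.out
  choose S f hS hf using h
  refine IsoClasses.card_le_of_family S hS fun c c' ⟨e⟩ => IsoClasses.eq_of_equiv ?_
  have := IsSimpleModule.nontrivial R (S c')
  have := c'.out_prop.2.1.1
  exact nonempty_equiv_of_projective_covers c.out_prop.2.1 c.out_prop.2.2 c'.out_prop.2.2
    (c'.out_prop.isUniserial hR) (e.toLinearMap ∘ₗ f c) (e.surjective.comp (hf c)) (f c') (hf c')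

theorem nonempty_equiv_of_simple {M S T : Type u} [AddCommGroup M] [Module R M] [AddCommGroup S]
    [Module R S] [AddCommGroup T] [Module R T] [IsSimpleModule R S] [IsSimpleModule R T]
    (hM : IsUniserial R M) (f : M →ₗ[R] S) (hf : Function.Surjective f) (g : M →ₗ[R] T)
    (hg : Function.Surjective g) : Nonempty (S ≃ₗ[R] T) := by
  wlog h : LinearMap.ker f ≤ LinearMap.ker g generalizing S T
  · obtain ⟨e⟩ := this g hg f hf ((hM _ _).resolve_left h)
    exact ⟨e.symm⟩
  obtain ⟨k, hk⟩ := f.exists_factor_of_surjective hf g fun x hx => h hx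
  have := IsSimpleModule.nontrivial R T
  refine ⟨LinearEquiv.ofBijective k (LinearMap.bijective_of_ne_zero fun h0 => ?_)⟩
  obtain ⟨y, hy⟩ := exists_ne (0 : T)
  obtain ⟨x, rfl⟩ := hg y
  exact hy (by rw [← hk, h0]; rfl)

/-- Choosing a cover of each simple module is injective on classes, since a uniserial module has
only one simple quotient up to isomorphism. -/
theorem numSimples_le_card_indecProj [IsArtinianRing R] (hR : IsLeftSerial R) :
    numSimples R ≤ ENat.card (IsoClasses R (IsIndecProj R)) := by
  have h (c : IsoClasses R fun M => IsSimpleModule R M) :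
      ∃ (P : ModuleCat.{u} R) (f : P →ₗ[R] c.out), Module.Finite R P ∧ IsIndecomposable R P ∧
        Module.Projective R P ∧ Function.Surjective f := by
    have : IsSimpleModule R c.out := c.out_prop
    exact exists_indecomposable_projective_cover c.out
  choose P f h1 h2 h3 hf using h
  refine IsoClasses.card_le_of_family P (fun c => ⟨h1 c, h2 c, h3 c⟩) fun c c' ⟨e⟩ =>
    IsoClasses.eq_of_equiv ?_
  have : IsSimpleModule R c.out := c.out_prop
  have : IsSimpleModule R c'.out := c'.out_prop
  exact nonempty_equiv_of_simple (hR (P c) (h1 c) (h3 c) (h2 c)) (f c) (hf c)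
    (f c' ∘ₗ e.toLinearMap) ((hf c').comp e.surjective)

theorem IsCosyzygy.exists_family [IsArtinianRing R] (hR : IsLeftSerial R) {P : ModuleCat.{u} R}
    (hP : IsIndecProjNonInj R P) {d : ℕ} (h : HasProjInjCoresolution R d P) {k : ℕ} (hk : k ≤ d) :
    ∃ Q : ModuleCat.{u} R, IsIndecProj R Q ∧ ∃ M, IsCosyzygy R P k M Q := by
  obtain ⟨M, Q, hM, -⟩ := exists_of_hasProjInjCoresolution hR hP k 0 (h.mono_le hk)
  exact ⟨Q, hM.isIndecProj hP.isIndecProj, M, hM⟩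

/-- The even positions `0, 2, …, 2 * (d c / 2)` contribute `d c / 2 + 1` covers for each class `c`.
-/
theorem sum_div_two_le [IsArtinianRing R] (hR : IsLeftSerial R) {n : ℕ} (hn : numSimples R = n)
    (s : Finset (IsoClasses R (IsIndecProjNonInj R))) (d : IsoClasses R (IsIndecProjNonInj R) → ℕ)
    (hd : ∀ c ∈ s, HasProjInjCoresolution R (d c) c.out) : ∑ c ∈ s, (d c / 2 + 1) ≤ n := by
  have h (x : Σ c : s, Fin (d c / 2 + 1)) :=
    IsCosyzygy.exists_family hR x.1.1.out_prop (hd x.1.1 x.1.2) (k := 2 * x.2) (by omega)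
  choose Q hQ M hM using h
  have key : ∀ x y : Σ c : s, Fin (d c / 2 + 1), y.2.1 ≤ x.2.1 → Nonempty (Q x ≃ₗ[R] Q y) →
      x = y := by
    rintro ⟨c, j⟩ ⟨c', j'⟩ hle ⟨e⟩
    obtain ⟨h1, h2⟩ := (hM ⟨c, j⟩).eq_of_even hR c.1.out_prop c'.1.out_prop (hM ⟨c', j'⟩) e
      (Nat.mul_le_mul_left 2 hle)
    obtain rfl : c = c' := Subtype.ext (IsoClasses.eq_of_equiv h1)
    have : j = j' := Fin.ext (by simpa using h2)
    rw [this]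
  have hcard := (IsoClasses.card_le_of_family Q hQ fun x y e => by
    rcases le_total y.2.1 x.2.1 with hle | hle
    · exact key x y hle e
    · exact (key y x hle ⟨e.some.symm⟩).symm).trans (card_indecProj_le_numSimples hR)
  rw [hn, ENat.card_eq_coe_fintype_card, Nat.cast_le, Fintype.card_sigma] at hcard
  simp only [Fintype.card_fin] at hcard
  rwa [Finset.sum_coe_sort s fun c => d c / 2 + 1] at hcard

theorem half_succ_le [IsArtinianRing R] (hR : IsLeftSerial R) {n : ℕ} (hn : numSimples R = n) {P : ModuleCat.{u} R}
    (hP : IsIndecProjNonInj R P) {d : ℕ} (hd : HasProjInjCoresolution R d P) :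
    (d + 1) / 2 + 1 ≤ n := by
  -- These are the even positions up to `d` and, when `d` is odd, also `d` itself. The comparison in
  -- `IsCosyzygy.eq_of_even` only needs the smaller position to be even.
  have h (j : Fin ((d + 1) / 2 + 1)) :=
    IsCosyzygy.exists_family hR hP hd (k := min (2 * j) d) (min_le_right _ _)
  choose Q hQ M hM using h
  have key : ∀ i j : Fin ((d + 1) / 2 + 1), i < j → Nonempty (Q i ≃ₗ[R] Q j) → False := by
    rintro ⟨i, hi⟩ ⟨j, hj⟩ hij ⟨e⟩
    rw [Fin.mk_lt_mk] at hij
    have hi' := hM ⟨i, hi⟩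
    rw [min_eq_left (show 2 * i ≤ d by omega)] at hi'
    have := ((hM ⟨j, hj⟩).eq_of_even hR hP hP hi' e.symm (by simp only; omega)).2
    simp only at this
    omega
  have hcard := (IsoClasses.card_le_of_family Q hQ fun i j e => by
    rcases lt_trichotomy i j with h | h | h
    · exact (key i j h e).elim
    · exact h
    · exact (key j i h ⟨e.some.symm⟩).elim).trans (card_indecProj_le_numSimples hR)
  rwa [hn, ENat.card_eq_coe_fintype_card, Nat.cast_le, Fintype.card_fin] at hcard

theorem sum_projInj_length_le [IsArtinianRing R] (hR : IsLeftSerial R) {n : ℕ} (hn : numSimples R = n)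
    (s : Finset (IsoClasses R (IsIndecProjNonInj R))) (d : IsoClasses R (IsIndecProjNonInj R) → ℕ)
    (hd : ∀ c ∈ s, HasProjInjCoresolution R (d c) c.out) : ∑ c ∈ s, d c ≤ 2 * n - 2 := by
  rcases Nat.lt_or_ge 1 s.card with hs | hs
  · have h1 := sum_div_two_le hR hn s d hd
    -- Rounding loses at most one per class, so the sum is at most `2 * n - s.card`.
    have h2 : ∑ c ∈ s, (d c + 1) ≤ ∑ c ∈ s, 2 * (d c / 2 + 1) :=
      Finset.sum_le_sum fun c _ => by omega
    rw [← Finset.mul_sum, Finset.sum_add_distrib] at h2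
    simp only [Finset.sum_const, smul_eq_mul, mul_one] at h2
    omega
  · rcases s.eq_empty_or_nonempty with rfl | h
    · simp
    · obtain ⟨c, rfl⟩ := Finset.card_eq_one.1 (le_antisymm hs h.card_pos)
      have := half_succ_le hR hn c.out_prop (hd c (Finset.mem_singleton_self c))
      rw [Finset.sum_singleton]
      omega

/-- There are at least as many indecomposable projective non-injective modules as there are
indecomposable injective non-projective ones. -/
theorem defect_le_card_indecProjNonInj [IsArtinianRing R] (hR : IsLeftSerial R) {n : ℕ} (hn : numSimples R = n) :
    defect R ≤ ENat.card (IsoClasses R (IsIndecProjNonInj R)) := by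
  let PI : ModuleCat.{u} R → Prop := fun M => IsIndecomposable R M ∧ IsFinProjInj R M
  have h (c : IsoClasses R (IsIndecInjNonProj R) ⊕ IsoClasses R PI) :
      ∃ J : ModuleCat.{u} R, Sum.elim IsoClasses.out IsoClasses.out c = J ∧
        Module.Finite R J ∧ IsIndecomposable R J ∧ Module.Injective R J ∧
        (Module.Projective R J ↔ c.isRight) := by
    rcases c with c | c
    · exact ⟨_, rfl, c.out_prop.1, c.out_prop.2.1, c.out_prop.2.2.1, iff_of_false c.out_prop.2.2.2 (by simp)⟩
    · exact ⟨_, rfl, c.out_prop.2.1, c.out_prop.1, c.out_prop.2.2.2, iff_of_true c.out_prop.2.2.1 rfl⟩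
  choose J hJ h1 h2 h3 h4 using h
  have h (c : IsoClasses R (IsIndecInjNonProj R) ⊕ IsoClasses R PI) :
      ∃ (S : ModuleCat.{u} R) (f : S →ₗ[R] J c), IsSimpleModule R S ∧ Function.Injective f := by
    have := h1 c
    have := (h2 c).1
    exact exists_simple_submodule (J c)
  choose S f hS hf using h
  -- Indecomposable injectives are distinguished by their simple submodules.
  have hle : ENat.card (IsoClasses R (IsIndecInjNonProj R) ⊕ IsoClasses R PI) ≤ numSimples R := by
    refine IsoClasses.card_le_of_family S hS fun c c' ⟨e⟩ => ?_
    have := IsSimpleModule.nontrivial R (S c)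
    have := h1 c
    have := h1 c'
    obtain ⟨ε⟩ := nonempty_equiv_of_injective_hulls (h2 c) (h3 c) (h2 c') (h3 c') (f c) (hf c)
      (f c' ∘ₗ e.toLinearMap) ((hf c').comp e.injective)
    have hpr : c.isRight ↔ c'.isRight := by
      rw [← h4, ← h4]
      exact ⟨fun h => h.of_equiv ε, fun h => h.of_equiv ε.symm⟩
    rw [← hJ c, ← hJ c'] at ε
    rcases c with c | c <;> rcases c' with c' | c'
    · exact congrArg _ (IsoClasses.eq_of_equiv ⟨ε⟩)
    · simp at hpr
    · simp at hpr
    · exact congrArg _ (IsoClasses.eq_of_equiv ⟨ε⟩)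
  have hge : ENat.card (IsoClasses R (IsIndecProj R)) ≤
      ENat.card (IsoClasses R (IsIndecProjNonInj R) ⊕ IsoClasses R PI) := by
    classical
    refine ENat.card_le_card_of_injective (f := fun c =>
      if h : Module.Injective R c.out then
        Sum.inr (IsoClasses.mk c.out ⟨c.out_prop.2.1, c.out_prop.1, c.out_prop.2.2, h⟩)
      else Sum.inl (IsoClasses.mk c.out ⟨c.out_prop.1, c.out_prop.2.1, c.out_prop.2.2, h⟩)) ?_
    intro c c' hcc
    dsimp only at hcc
    split_ifs at hcc with h h'
    · exact IsoClasses.eq_of_equiv (IsoClasses.mk_eq_mk.1 (Sum.inr_injective hcc))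
    · exact IsoClasses.eq_of_equiv (IsoClasses.mk_eq_mk.1 (Sum.inl_injective hcc))
  -- Both ends contain the number of projective injective classes, which is finite and cancels.
  have htot := hle.trans ((numSimples_le_card_indecProj hR).trans hge)
  rw [ENat.card_sum] at hle
  rw [ENat.card_sum, ENat.card_sum] at htot
  have hfin : ENat.card (IsoClasses R PI) ≠ ⊤ := fun h => by
    rw [h, hn, add_top] at hle
    exact absurd hle (by simp)
  exact (ENat.add_le_add_iff_right hfin).1 htot

end Counting

/-! ### From dominant dimension to coresolutions -/

section DomDim

variable {R : Type u} [Ring R]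

/-- A projective essential extension of a finitely generated module is finitely generated. -/
theorem IsEssentialSubmodule.finite_of_projective [IsNoetherianRing R] {M I : Type u}
    [AddCommGroup M] [Module R M] [AddCommGroup I] [Module R I] [Module.Finite R M]
    (hI : Module.Projective R I) (f : M →ₗ[R] I) (hf : IsEssentialSubmodule (LinearMap.range f)) :
    Module.Finite R I := by
  obtain ⟨s, hs⟩ := hI.out
  classical
  obtain ⟨t, ht⟩ := Module.Finite.fg_top (R := R) (M := M)
  -- `T` holds the coordinates used by generators of `M`. Projecting to them is injective on the
  -- image of `M`, hence on `I` by essentiality.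
  let T : Finset I := t.biUnion fun x => (s (f x)).support
  have hT : ∀ m, s (f m) ∈ Finsupp.supported R R (T : Set I) := by
    have : (⊤ : Submodule R M) ≤ (Finsupp.supported R R (T : Set I)).comap (s ∘ₗ f) := by
      rw [← ht, Submodule.span_le]
      intro x hx
      change s (f x) ∈ Finsupp.supported R R (T : Set I)
      rw [Finsupp.mem_supported]
      exact_mod_cast Finset.subset_biUnion_of_mem (fun x => (s (f x)).support) hx
    exact fun m => this trivial
  let r : I →ₗ[R] (T → R) := LinearMap.pi fun i => Finsupp.lapply i.1 ∘ₗ s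
  have hr : LinearMap.ker r = ⊥ := by
    refine hf _ ?_
    rw [eq_bot_iff]
    rintro _ ⟨⟨m, rfl⟩, hm⟩
    have h0 : s (f m) = 0 := by
      ext i
      by_cases hi : i ∈ T
      · exact congrFun hm ⟨i, hi⟩
      · by_contra hne
        exact hi (hT m (Finsupp.mem_support_iff.2 hne))
    have := hs (f m)
    rw [h0, map_zero] at this
    exact this.symm
  exact Module.Finite.of_injective r (LinearMap.ker_eq_bot.1 hr)

/-- The first cosyzygy of a minimal injective coresolution. -/
def MinimalInjectiveCoresolution.shift {M : Type u} [AddCommGroup M] [Module R M]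
    (C : MinimalInjectiveCoresolution R M) :
    MinimalInjectiveCoresolution R (LinearMap.range (C.d 0)) where
  I i := C.I (i + 1)
  ε := (LinearMap.range (C.d 0)).subtype
  d i := C.d (i + 1)
  injective i := C.injective (i + 1)
  ε_injective := Submodule.injective_subtype _
  exact_zero x := by
    rw [C.exact_succ 0 x]
    simp
  exact_succ i := C.exact_succ (i + 1)
  essential_zero := by
    rw [Submodule.range_subtype]
    exact C.essential_succ 0
  essential_succ i := C.essential_succ (i + 1)

theorem MinimalInjectiveCoresolution.hasProjInjCoresolution [IsNoetherianRing R] {d : ℕ}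
    {M : Type u} [AddCommGroup M] [Module R M] [hM : Module.Finite R M]
    (C : MinimalInjectiveCoresolution R M) (hC : ∀ i < d, Module.Projective R (C.I i)) :
    HasProjInjCoresolution R d M := by
  induction d generalizing M with
  | zero => trivial
  | succ d ih =>
    have h0 := hC 0 (Nat.succ_pos d)
    have := C.essential_zero.finite_of_projective h0 C.ε
    refine ⟨C.I 0, ModuleCat.of R (LinearMap.range (C.d 0)), C.ε, (C.d 0).rangeRestrict,
      ⟨this, h0, C.injective 0⟩, C.ε_injective, LinearMap.surjective_rangeRestrict _, fun x => ?_,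
      ih C.shift fun i hi => hC (i + 1) (Nat.succ_lt_succ hi)⟩
    rw [← C.exact_zero x, ← Subtype.coe_inj]
    rfl

theorem hasProjInjCoresolution_of_le_domDim [IsNoetherianRing R] {d : ℕ} {M : Type u}
    [AddCommGroup M] [Module R M] [Module.Finite R M] (h : (d : ℕ∞) ≤ domDim R M) :
    HasProjInjCoresolution R d M := by
  cases d with
  | zero => trivial
  | succ d =>
    have hlt : (d : ℕ∞) < domDim R M := lt_of_lt_of_le (by exact_mod_cast Nat.lt_succ_self d) h
    obtain ⟨C, hC⟩ := lt_iSup_iff.1 hlt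
    obtain ⟨k, hk⟩ := lt_iSup_iff.1 hC
    obtain ⟨hk', hdk⟩ := lt_iSup_iff.1 hk
    exact (C.hasProjInjCoresolution hk').mono_le (Nat.succ_le_of_lt (by exact_mod_cast hdk))

theorem HasProjInjCoresolution.of_finite_projective {d : ℕ} (h : HasProjInjCoresolution R d R)
    {P : Type u} [AddCommGroup P] [Module R P] [Module.Finite R P] (hP : Module.Projective R P) :
    HasProjInjCoresolution R d P := by
  have hpi : ∀ m : ℕ, HasProjInjCoresolution R d (Fin m → R) := fun m => by
    induction m with
    | zero => exact of_subsingleton d _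
    | succ m ih =>
      let e := Fin.consLinearEquiv R fun _ : Fin (m + 1) => R
      exact (h.prod ih).of_retract e.symm.toLinearMap e.toLinearMap (by simp)
  obtain ⟨m, f, hf⟩ := Module.Finite.exists_fin' R P
  obtain ⟨s, hs⟩ := hP.exists_section f hf
  exact (hpi m).of_retract s f hs

end DomDim

/-! ### The dual of the regular module and injective embeddings -/

section Dual

variable (K : Type v) (A : Type u) [Field K] [Ring A] [Algebra K A]

/-- The `K`-dual of the right regular module of a `K`-algebra `A`. -/
def RegularDual : Type (max u v) := A →ₗ[K] K

namespace RegularDual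

instance : AddCommGroup (RegularDual K A) := inferInstanceAs (AddCommGroup (A →ₗ[K] K))

instance : Module A (RegularDual K A) where
  smul a φ := LinearMap.comp (φ : A →ₗ[K] K) (LinearMap.mulRight K a)
  one_smul φ := LinearMap.ext fun x => congrArg φ.toFun (mul_one x)
  mul_smul a b φ := LinearMap.ext fun x => congrArg φ.toFun (mul_assoc x a b).symm
  smul_zero _ := rfl
  smul_add _ _ _ := rfl
  add_smul a b φ := LinearMap.ext fun x =>
    (congrArg φ.toFun (mul_add x a b)).trans (φ.map_add' _ _)
  zero_smul φ := LinearMap.ext fun x => (congrArg φ.toFun (mul_zero x)).trans (LinearMap.map_zero φ)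

variable {K A}

/-- Evaluation of a functional. -/
def eval (φ : RegularDual K A) : A →ₗ[K] K := φ

theorem eval_smul (a x : A) (φ : RegularDual K A) : eval (a • φ) x = eval φ (x * a) := rfl

/-- Evaluation at `1` turns an `A`-linear map from a left ideal to the dual into a `K`-functional on
the ideal, which extends to `A`. -/
theorem baer : Module.Baer A (RegularDual K A) := by
  intro I g
  let ψ₀ : I.restrictScalars K →ₗ[K] K :=
    { toFun := fun x => eval (g ⟨x.1, x.2⟩) 1
      map_add' := fun x y =>
        congrArg (fun φ => eval φ 1) (g.map_add ⟨x.1, x.2⟩ ⟨y.1, y.2⟩)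
      map_smul' := fun k x => by
        have h : k • x.1 ∈ I := (k • x).2
        have : g ⟨k • x.1, h⟩ = algebraMap K A k • g ⟨x.1, x.2⟩ :=
          (congrArg g (Subtype.ext (Algebra.smul_def _ _))).trans (g.map_smul _ _)
        change eval (g ⟨k • x.1, h⟩) 1 = _
        rw [this, eval_smul, one_mul, Algebra.algebraMap_eq_smul_one, map_smul]
        rfl }
  obtain ⟨ψ, hψ⟩ := ψ₀.exists_extend
  refine ⟨{ toFun := fun a => (ψ ∘ₗ LinearMap.mulRight K a : A →ₗ[K] K)
            map_add' := fun a b => LinearMap.ext fun x => by simp [mul_add]; rfl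
            map_smul' := fun a b => LinearMap.ext fun x => ?_ }, fun a ha => ?_⟩
  · change ψ (x * (a * b)) = ψ (x * a * b)
    rw [mul_assoc]
  · refine LinearMap.ext fun x => ?_
    change ψ (x * a) = eval (g ⟨a, ha⟩) x
    have h1 : ψ (x * a) = ψ₀ ⟨x * a, I.mul_mem_left x ha⟩ :=
      LinearMap.congr_fun hψ ⟨x * a, I.mul_mem_left x ha⟩
    have h2 : g ⟨x * a, I.mul_mem_left x ha⟩ = x • g ⟨a, ha⟩ := by
      rw [← map_smul]
      rfl
    rw [h1]
    change eval (g ⟨x * a, _⟩) 1 = _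
    rw [h2, eval_smul, one_mul]

theorem finite [FiniteDimensional K A] : Module.Finite A (RegularDual K A) := by
  let m : Module K (RegularDual K A) := inferInstanceAs (Module K (A →ₗ[K] K))
  have : Module.Finite K (RegularDual K A) := inferInstanceAs (Module.Finite K (A →ₗ[K] K))
  have : IsScalarTower K A (RegularDual K A) := ⟨fun k a φ => LinearMap.ext fun x => by
    change eval φ (x * (k • a)) = k • eval φ (x * a)
    rw [mul_smul_comm, map_smul]⟩
  exact Module.Finite.of_restrictScalars_finite K A _

/-- The field embeds in the nonzero algebra, which brings the dual down to the universe of `A`. -/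
instance [Nontrivial A] : Small.{u} (RegularDual K A) := by
  have : Small.{u} K := small_of_injective (algebraMap K A).injective
  exact small_of_injective (β := A → K) (f := fun φ => ⇑(eval φ)) fun φ ψ h =>
    LinearMap.ext fun x => congrFun h x

end RegularDual

variable {A}

/-- Finitely generated modules over a finite-dimensional algebra embed in finitely generated
injective modules. -/
theorem exists_finite_injective_embedding [FiniteDimensional K A] [Nontrivial A] (M : Type u)
    [AddCommGroup M] [Module A M] [Module.Finite A M] :
    ∃ (J : ModuleCat.{u} A) (f : M →ₗ[A] J), Module.Finite A J ∧ Module.Injective A J ∧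
      Function.Injective f := by
  let D := Shrink.{u} (RegularDual K A)
  let e : D ≃ₗ[A] RegularDual K A := Shrink.linearEquiv A _
  have hD : Module.Injective A D := (RegularDual.baer.of_equiv e.symm).injective
  have hDf : Module.Finite A D := by
    have := RegularDual.finite (K := K) (A := A)
    exact Module.Finite.equiv e.symm
  let _ : Module K M := Module.compHom M (algebraMap K A)
  have : IsScalarTower K A M := ⟨fun k a m => by
    rw [Algebra.smul_def, mul_smul]
    rfl⟩
  have : Module.Finite K M := Module.Finite.trans A M
  let b := Module.finBasis K M
  -- The component `i` of `F x` is `a ↦ b.coord i (a • x)`; its value at `a = 1` recovers the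
  -- coordinates of `x`.
  let F : M →ₗ[A] (Fin (Module.finrank K M) → RegularDual K A) :=
    { toFun := fun x i => (b.coord i ∘ₗ (LinearMap.toSpanSingleton A M x).restrictScalars K :
        A →ₗ[K] K)
      map_add' := fun x y => funext fun i => LinearMap.ext fun a => by
        change b.coord i (a • (x + y)) = b.coord i (a • x) + b.coord i (a • y)
        rw [smul_add, map_add]
      map_smul' := fun r x => funext fun i => LinearMap.ext fun a => by
        change b.coord i (a • r • x) = b.coord i ((a * r) • x)
        rw [mul_smul] }
  refine ⟨ModuleCat.of A (Fin (Module.finrank K M) → D),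
    LinearMap.pi fun i => e.symm.toLinearMap ∘ₗ LinearMap.proj i ∘ₗ F,
    inferInstanceAs (Module.Finite A (Fin (Module.finrank K M) → D)), ⟨?_⟩, ?_⟩
  · intro X Y _ _ _ _ f hf g
    choose h hh using fun i => hD.out f hf (LinearMap.proj i ∘ₗ g)
    exact ⟨LinearMap.pi h, fun x => funext fun i => hh i x⟩
  · rw [injective_iff_map_eq_zero]
    intro x hx
    refine b.ext_elem fun i => ?_
    have h1 : e.symm (F x i) = 0 := congrFun hx i
    have h2 : F x i = 0 := e.symm.map_eq_zero_iff.1 h1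
    have h3 : b.coord i ((1 : A) • x) = 0 := LinearMap.congr_fun (f := (F x i : A →ₗ[K] K)) h2 1
    simpa using h3

end Dual

/-! ### The bounds -/

section Main

variable {R : Type u} [Ring R]

theorem HasProjInjCoresolution.of_embeddings
    (h : ∀ M : ModuleCat.{u} R, Module.Finite R M → ∃ (J : ModuleCat.{u} R) (f : M →ₗ[R] J),
      IsFinProjInj R J ∧ Function.Injective f) (d : ℕ) (M : ModuleCat.{u} R)
    (hM : Module.Finite R M) : HasProjInjCoresolution R d M := by
  induction d generalizing M with
  | zero => trivial
  | succ d ih =>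
    obtain ⟨J, f, hJ, hf⟩ := h M hM
    have := hJ.1
    exact ⟨J, ModuleCat.of R (J ⧸ LinearMap.range f), f, (LinearMap.range f).mkQ, hJ, hf,
      Submodule.mkQ_surjective _, LinearMap.exact_map_mkQ_range f, ih _ inferInstance⟩

theorem card_indecProjNonInj_le (hR : IsLeftSerial R) {n : ℕ} (hn : numSimples R = n) :
    ENat.card (IsoClasses R (IsIndecProjNonInj R)) ≤ n :=
  hn ▸ (IsoClasses.card_le_of_family IsoClasses.out (fun c => c.out_prop.isIndecProj)
    fun _ _ => IsoClasses.eq_of_equiv).trans (card_indecProj_le_numSimples hR)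

variable [IsArtinianRing R]

/-- An infinite value would give a coresolution of length `2 * n`, contradicting `half_succ_le`. -/
theorem exists_domDim_eq (hR : IsLeftSerial R) {n : ℕ} (hn : numSimples R = n)
    (c : IsoClasses R (IsIndecProjNonInj R)) :
    ∃ d : ℕ, c.domDim = d ∧ HasProjInjCoresolution R d c.out := by
  have := c.out_prop.1
  rw [c.domDim_eq]
  have hfin : domDim R c.out ≠ ⊤ := fun h => by
    have := half_succ_le hR hn c.out_prop
      (hasProjInjCoresolution_of_le_domDim (d := 2 * n) (h ▸ le_top))
    omega
  obtain ⟨d, hd⟩ := ENat.ne_top_iff_exists.1 hfin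
  exact ⟨d, hd.symm, hasProjInjCoresolution_of_le_domDim hd.le⟩

theorem superDomDim_le (hR : IsLeftSerial R) {n : ℕ} (hn : numSimples R = n) :
    superDomDim R ≤ ((2 * n - 2 : ℕ) : ℕ∞) := by
  choose d hd hd' using exists_domDim_eq hR hn
  refine iSup_le fun s => ?_
  rw [Finset.sum_congr rfl fun c _ => hd c, ← Nat.cast_sum, Nat.cast_le]
  exact sum_projInj_length_le hR hn s d fun c _ => hd' c

theorem exists_indecProjNonInj (hR : ¬ IsSelfinjective R) :
    Nonempty (IsoClasses R (IsIndecProjNonInj R)) := by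
  by_contra hne
  refine hR (injective_of_projective (fun J h1 h2 h3 => ?_) R inferInstance)
  by_contra h4
  exact hne ⟨IsoClasses.mk J ⟨h1, h2, h3, h4⟩⟩

/-- Finitely generated projectives inherit coresolutions of length `d` from `R`, so the bound on
sums applies to the constant `d`. -/
theorem mul_defect_le (hR : IsLeftSerial R) {n d δ : ℕ} (hn : numSimples R = n)
    (hd : (d : ℕ∞) ≤ domDim R R) (hδ : (δ : ℕ∞) ≤ ENat.card (IsoClasses R (IsIndecProjNonInj R))) :
    d * δ ≤ 2 * n - 2 := by
  have : Finite (IsoClasses R (IsIndecProjNonInj R)) :=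
    ENat.card_lt_top.1 ((card_indecProjNonInj_le hR hn).trans_lt (ENat.natCast_lt_top n))
  have := Fintype.ofFinite (IsoClasses R (IsIndecProjNonInj R))
  have h := sum_projInj_length_le hR hn Finset.univ (fun _ => d) fun c _ => by
    have := c.out_prop.1
    exact (hasProjInjCoresolution_of_le_domDim hd).of_finite_projective c.out_prop.2.2.1
  rw [ENat.card_eq_coe_fintype_card, Nat.cast_le] at hδ
  rw [Finset.sum_const, Finset.card_univ, smul_eq_mul] at h
  exact (Nat.mul_comm d δ ▸ Nat.mul_le_mul_right d hδ).trans h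

/-- With zero defect the injective embeddings are projective injective, and iterating them
coresolves a projective non-injective module to length `2 * n`, which is too long. -/
theorem defect_ne_zero (hR : IsLeftSerial R) (hself : ¬ IsSelfinjective R)
    (hemb : ∀ M : ModuleCat.{u} R, Module.Finite R M → ∃ (J : ModuleCat.{u} R) (f : M →ₗ[R] J),
      Module.Finite R J ∧ Module.Injective R J ∧ Function.Injective f) {n : ℕ}
    (hn : numSimples R = n) : defect R ≠ 0 := by
  intro h0
  have hempty := (ENat.card_eq_zero_iff_empty _).1 h0
  have hproj := projective_of_injective (R := R) fun J h1 h2 h3 => by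
    by_contra h4
    exact hempty.elim (IsoClasses.mk J ⟨h1, h2, h3, h4⟩)
  obtain ⟨c⟩ := exists_indecProjNonInj hself
  have := half_succ_le hR hn c.out_prop (HasProjInjCoresolution.of_embeddings (fun M hM => by
    obtain ⟨J, f, h1, h2, h3⟩ := hemb M hM
    exact ⟨J, f, ⟨h1, hproj J h2, h2⟩, h3⟩) (2 * n) c.out c.out_prop.1)
  omega

end Main

theorem mainTheorem6 {K : Type v} {A : Type u} [Field K] [Ring A] [Algebra K A]
    [FiniteDimensional K A] (hconn : IsConnectedRing A) (hNak : IsNakayama A)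
    (hself : ¬ IsSelfinjective A) (n : ℕ) (hn : numSimples A = n) :
    superDomDim A ≤ ((2 * n - 2 : ℕ) : ℕ∞) ∧
    (∃ d δ : ℕ, domDim A A = d ∧ defect A = δ ∧ 0 < δ ∧ (d : ℚ) ≤ (2 * (n : ℚ) - 2) / (δ : ℚ)) ∧
    ((n : ℕ∞) ≤ domDim A A → defect A = 1) := by
  have hR := hNak.1
  have : Nontrivial A := hconn.1
  have : IsArtinianRing A := IsArtinianRing.of_finite K A
  obtain ⟨c⟩ := exists_indecProjNonInj hself
  -- This keeps the truncated subtraction `2 * n - 2` honest.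
  have hn1 : 1 ≤ n := half_succ_le hR hn c.out_prop (d := 0) trivial
  have hr1 : ((1 : ℕ) : ℕ∞) ≤ ENat.card (IsoClasses A (IsIndecProjNonInj A)) :=
    (ENat.one_le_card_iff_nonempty _).2 ⟨c⟩
  have hdef := defect_le_card_indecProjNonInj hR hn
  have hdom : domDim A A ≠ ⊤ := fun h => by
    have := mul_defect_le hR hn (d := 2 * n) (h ▸ le_top) hr1
    omega
  have hdef' : defect A ≠ ⊤ := fun h => by
    have := hdef.trans (card_indecProjNonInj_le hR hn)
    rw [h] at this
    exact absurd this (by simp)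
  have hdef0 := defect_ne_zero hR hself (fun M _ => exists_finite_injective_embedding K M) hn
  obtain ⟨d, hd⟩ := ENat.ne_top_iff_exists.1 hdom
  obtain ⟨δ, hδ⟩ := ENat.ne_top_iff_exists.1 hdef'
  have hmul := mul_defect_le hR hn hd.le (hδ ▸ hdef)
  have hδ0 : 0 < δ := Nat.pos_of_ne_zero fun h => hdef0 (by rw [← hδ, h]; rfl)
  refine ⟨superDomDim_le hR hn, ⟨d, δ, hd.symm, hδ.symm, hδ0, ?_⟩, fun h => ?_⟩
  · rw [le_div_iff₀ (by exact_mod_cast hδ0)]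
    have h2 : d * δ + 2 ≤ 2 * n := by omega
    have h3 : (d : ℚ) * δ + 2 ≤ 2 * n := by exact_mod_cast h2
    linarith
  · rw [← hd, Nat.cast_le] at h
    have h2 : n * δ ≤ 2 * n - 2 := (Nat.mul_le_mul_right δ h).trans hmul
    have h3 : δ < 2 := by
      by_contra hge
      have := Nat.mul_le_mul_left n (not_lt.1 hge)
      omega
    rw [← hδ, show δ = 1 by omega]
    rfl
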